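/- Let $G$ be a finite group with derived subgroup $G'$. Characters are complex characters, and the kernel of a character $\chi$ is $\ker\chi=\{g\in G : \chi(g)=\chi(1)\}$. An irreducible character is nonlinear if $\chi(1)\neq 1$. For normal subgroups $K<H$ of $G$, $H/K$ is a chief factor of $G$ if no normal subgroup of $G$ lies strictly between $K$ and $H$. A waist of $G$ is a normal subgroup $W$ of $G$ such that every normal subgroup $N$ of $G$ satisfies $N\le W$ or $W\le N$. Then the following two conditions are equivalent: (1) The kernels of the nonlinear irreducible characters of $G$ form a chain with respect to inclusion. (3) Every normal subgroup $M$ of $G$ with $1\le M<G'$ satisfies one of the following: (a) $G'/M$ is not a chief factor of $G$ and $G/M$ has a unique minimal normal subgroup, or (b) $G'/M$ is a chief factor of $G$ and $G/M$ has at most two minimal normal subgroups. If moreover $G$ is nonabelian, then (1) and (3) are also equivalent to the following condition: (2) Every normal subgroup $M$ of $G$ with $1\le M<G'$ is a waist of $G$; there is a unique normal subgroup $M$ of $G$ such that $G'/M$ is a chief factor of $G$; and, for this $M$, the quotient $G/M$ has at most two minimal normal subgroups. -/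

import Mathlib

/-- `χ` is an (ordinary, complex) irreducible character of `G`: the trace function of an
irreducible representation of `G` on a finite-dimensional complex vector space. -/
def IsIrrChar {G : Type*} [Group G] (χ : G → ℂ) : Prop :=
  ∃ (n : ℕ) (ρ : Representation ℂ G (Fin n → ℂ)), ρ.IsIrreducible ∧ χ = ρ.character

/-- The kernel `{g | χ g = χ 1}` of a character. -/
def charKer {G : Type*} [Group G] (χ : G → ℂ) : Set G :=
  {g | χ g = χ 1}

/-- The set of kernels of the nonlinear irreducible characters of `G`
(those whose degree `χ 1` is not `1`). -/
def nlKern (G : Type*) [Group G] : Set (Set G) :=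
  {K | ∃ χ : G → ℂ, IsIrrChar χ ∧ χ 1 ≠ 1 ∧ K = charKer χ}

/-- `W` is a waist of `G`: a normal subgroup comparable with every normal subgroup of `G`. -/
def IsWaist {G : Type*} [Group G] (W : Subgroup G) : Prop :=
  W.Normal ∧ ∀ N : Subgroup G, N.Normal → N ≤ W ∨ W ≤ N

/-- `H/K` is a chief factor of `G`: `K < H` are normal subgroups of `G` and no normal subgroup
of `G` lies strictly between them. -/
def IsChiefFactor {G : Type*} [Group G] (H K : Subgroup G) : Prop :=
  H.Normal ∧ K.Normal ∧ K < H ∧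
    ∀ L : Subgroup G, L.Normal → K ≤ L → L ≤ H → L = K ∨ L = H

/-- `N` is a minimal normal subgroup of `G`: minimal among the nontrivial normal subgroups. -/
def IsMinimalNormal {G : Type*} [Group G] (N : Subgroup G) : Prop :=
  N.Normal ∧ N ≠ ⊥ ∧ ∀ L : Subgroup G, L.Normal → L ≤ N → L = ⊥ ∨ L = N

/-! Characters enter only through `isChain_nlKern_iff`. A nonlinear irreducible character has a
kernel not containing `G'`. Conversely, if `N` does not contain `G'`, then `G/N` is nonabelian, and
its nonlinear irreducible characters have trivial common kernel, so `N` is an intersection of such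
kernels. Condition (1) thus says that the normal subgroups not containing `G'` form a chain, and the
rest concerns normal subgroups only.

From a chain, (2) and (3) follow by comparing preimages of minimal normal subgroups. For the
converse, let `N₁`, `N₂` not contain `G'`. Either minimality or the waist property settles the
matter, or `N₁` and `N₂` both meet `G'` in some `M` with `G'/M` chief. Modulo `M` they meet the
derived subgroup trivially, hence are central. The bound of two minimal normal subgroups makes their
product a `q`-group with one subgroup of order `q`, whose subgroups form a chain
(`le_or_le_of_inf_commutator_eq_bot`). -/

/-! ### Irreducible representations and the kernels of their characters. -/

theorem Representation.isIrreducible_iff_invariant {k G V : Type*} [Field k] [Monoid G]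
    [AddCommGroup V] [Module k V] (ρ : Representation k G V) :
    ρ.IsIrreducible ↔ Nontrivial V ∧
      ∀ p : Submodule k V, (∀ g, ∀ v ∈ p, ρ g v ∈ p) → p = ⊥ ∨ p = ⊤ := by
  constructor
  · intro h
    refine ⟨?_, fun p hp => ?_⟩
    · by_contra hV
      rw [not_nontrivial_iff_subsingleton] at hV
      refine bot_ne_top (α := Subrepresentation ρ) (Subrepresentation.toSubmodule_injective ?_)
      exact Subsingleton.elim _ _
    · rcases h.eq_bot_or_eq_top ⟨p, fun g v hv => hp g v hv⟩ with h1 | h1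
      · exact Or.inl (congrArg Subrepresentation.toSubmodule h1)
      · exact Or.inr (congrArg Subrepresentation.toSubmodule h1)
  · rintro ⟨hV, h⟩
    refine { exists_pair_ne := ⟨⊥, ⊤, fun e => ?_⟩, eq_bot_or_eq_top := fun p => ?_ }
    · exact bot_ne_top (α := Submodule k V) (congrArg Subrepresentation.toSubmodule e)
    · rcases h p.toSubmodule (fun g v hv => p.apply_mem_toSubmodule g hv) with h1 | h1
      · exact Or.inl (Subrepresentation.toSubmodule_injective h1)
      · exact Or.inr (Subrepresentation.toSubmodule_injective h1)

/-- An irreducible complex representation killing the derived subgroup has dimension one. -/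
theorem Representation.IsIrreducible.finrank_eq_one_of_commutator_le_ker {G V : Type*} [Group G]
    [AddCommGroup V] [Module ℂ V] [FiniteDimensional ℂ V] {ρ : Representation ℂ G V}
    (hρ : ρ.IsIrreducible) (h : commutator G ≤ MonoidHom.ker ρ) : Module.finrank ℂ V = 1 := by
  let σ : Representation ℂ (Abelianization G) V := QuotientGroup.lift (commutator G) ρ h
  have hσ : σ.IsIrreducible := by
    rw [Representation.isIrreducible_iff_invariant] at hρ ⊢
    exact ⟨hρ.1, fun p hp => hρ.2 p fun g v hv => hp (QuotientGroup.mk g) v hv⟩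
  exact Representation.IsIrreducible.finrank_eq_one_of_isMulCommutative σ

/-- A family of complex numbers in the closed unit disc whose sum is its cardinality is constantly
one. -/
theorem Multiset.eq_one_of_sum_eq_card {s : Multiset ℂ} (hs : ∀ z ∈ s, ‖z‖ ≤ 1)
    (h : s.sum = s.card) : ∀ z ∈ s, z = 1 := by
  -- The induction carries the inequality of real parts along with its equality case; equality in
  -- `re z ≤ ‖z‖ ≤ 1` forces `z = 1`.
  have key : ∀ s : Multiset ℂ, (∀ z ∈ s, ‖z‖ ≤ 1) →
      s.sum.re ≤ s.card ∧ (s.sum.re = s.card → ∀ z ∈ s, z = 1) := by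
    intro s
    induction s using Multiset.induction with
    | empty => simp
    | cons a s ih =>
      intro hs
      obtain ⟨h1, h2⟩ := ih fun z hz => hs z (Multiset.mem_cons_of_mem hz)
      have ha := hs a (Multiset.mem_cons_self a s)
      have ha' := a.re_le_norm
      rw [Multiset.sum_cons, Multiset.card_cons, Complex.add_re]
      push_cast
      refine ⟨by linarith, fun he z hz => ?_⟩
      rcases Multiset.mem_cons.1 hz with rfl | hz
      · have h3 : z.re = ‖z‖ := by linarith
        have h4 : ‖z‖ = 1 := by linarith
        apply Complex.ext
        · rw [h3, h4]; simp
        · have := Complex.abs_re_eq_norm.1 (by rw [h3]; simp)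
          simpa using this
      · exact h2 (by linarith) z hz
  exact (key s hs).2 (by rw [h]; simp)

/-- A complex matrix of finite multiplicative order whose trace is its size is the identity. -/
theorem Matrix.eq_one_of_pow_eq_one_of_trace_eq_card {n : Type*} [Fintype n] [DecidableEq n]
    {A : Matrix n n ℂ} {m : ℕ} (hm : m ≠ 0) (hA : A ^ m = 1)
    (htr : A.trace = Fintype.card n) : A = 1 := by
  open Polynomial in
  have hsplit : A.charpoly.Splits := IsAlgClosed.splits _
  have hroot : ∀ z ∈ A.charpoly.roots, z ^ m = 1 := by
    intro z hz
    have hz' : z ∈ spectrum ℂ A := by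
      rw [Matrix.mem_spectrum_iff_isRoot_charpoly]
      exact (mem_roots'.1 hz).2
    have := spectrum.pow_mem_pow A m hz'
    rw [hA] at this
    rcases isEmpty_or_nonempty n with hn | hn
    · exact absurd this (by simp [spectrum.of_subsingleton])
    · simpa [spectrum.one_eq] using this
  have hcard : A.charpoly.roots.card = Fintype.card n := by
    rw [← hsplit.natDegree_eq_card_roots, Matrix.charpoly_natDegree_eq_dim]
  have hone : ∀ z ∈ A.charpoly.roots, z = 1 := by
    apply Multiset.eq_one_of_sum_eq_card
    · intro z hz
      exact (Complex.norm_eq_one_of_pow_eq_one (hroot z hz) hm).le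
    · rw [← Matrix.trace_eq_sum_roots_charpoly, htr, hcard]
  have hchar : A.charpoly = (X - C 1) ^ Fintype.card n := by
    rw [hsplit.eq_prod_roots_of_monic A.charpoly_monic,
      Multiset.eq_replicate.2 ⟨hcard, hone⟩]
    simp
  -- The minimal polynomial divides a power of `X - 1` and the separable `X ^ m - 1`, hence divides
  -- `X - 1` itself.
  have hd1 : minpoly ℂ A ∣ (X - C 1) ^ Fintype.card n := hchar ▸ Matrix.minpoly_dvd_charpoly A
  have hd2 : minpoly ℂ A ∣ X ^ m - 1 := minpoly.dvd _ _ (by simp [hA])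
  have hsep : (X ^ m - 1 : ℂ[X]).Separable :=
    (X_pow_sub_one_separable_iff).2 (by exact_mod_cast hm)
  have hsq : Squarefree (minpoly ℂ A) := (hsep.of_dvd hd2).squarefree
  have hd3 : minpoly ℂ A ∣ X - C 1 := by
    rcases eq_or_ne (Fintype.card n) 0 with h0 | h0
    · rw [h0, pow_zero] at hd1
      exact hd1.trans (one_dvd _)
    · exact (hsq.dvd_pow_iff_dvd h0).1 hd1
  have := minpoly.aeval ℂ A
  obtain ⟨q, hq⟩ := hd3
  have h0 : aeval A (X - C (1 : ℂ)) = 0 := by rw [hq, map_mul, this, zero_mul]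
  simpa [sub_eq_zero] using h0

/-- Each `ρ g` has finite order, so its trace equals the degree only when `ρ g` is the identity. -/
theorem charKer_character {G : Type*} [Group G] [Finite G] {n : ℕ}
    (ρ : Representation ℂ G (Fin n → ℂ)) :
    charKer ρ.character = (MonoidHom.ker ρ : Set G) := by
  ext g
  simp only [charKer, Set.mem_ofPred_eq, SetLike.mem_coe, MonoidHom.mem_ker]
  constructor
  · intro h
    have h1 : LinearMap.toMatrix' (ρ g) = 1 := by
      refine Matrix.eq_one_of_pow_eq_one_of_trace_eq_card (m := orderOf g)
        (orderOf_pos g).ne' ?_ ?_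
      · change (LinearMap.toMatrixAlgEquiv' (ρ g)) ^ _ = 1
        rw [← map_pow, ← map_pow, pow_orderOf_eq_one, map_one, map_one]
      · rw [Representation.char_one, Representation.character,
          LinearMap.trace_eq_matrix_trace ℂ (Pi.basisFun ℂ (Fin n)),
          LinearMap.toMatrix_eq_toMatrix'] at h
        simpa using h
    apply LinearMap.toMatrixAlgEquiv'.injective
    rw [map_one]; exact h1
  · intro h
    simp [Representation.character, h]

/-- Moves a representation to `Fin n → ℂ`, the only spaces that `IsIrrChar` admits. -/
theorem Representation.IsIrreducible.conj {k G V W : Type*} [Field k] [Monoid G]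
    [AddCommGroup V] [Module k V] [AddCommGroup W] [Module k W] {ρ : Representation k G V}
    (hρ : ρ.IsIrreducible) (e : V ≃ₗ[k] W) :
    Representation.IsIrreducible (e.conjRingEquiv.toMonoidHom.comp ρ : Representation k G W) := by
  rw [Representation.isIrreducible_iff_invariant] at hρ ⊢
  refine ⟨have := hρ.1; e.symm.toEquiv.nontrivial, fun p hp => ?_⟩
  have hmap : (p.comap (e : V →ₗ[k] W)).map (e : V →ₗ[k] W) = p :=
    Submodule.map_comap_eq_of_surjective e.surjective p
  have hinv : ∀ g, ∀ v ∈ p.comap (e : V →ₗ[k] W), ρ g v ∈ p.comap (e : V →ₗ[k] W) := by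
    intro g v hv
    have := hp g (e v) hv
    simpa [LinearEquiv.conjRingEquiv] using this
  rcases hρ.2 _ hinv with h | h
  · left
    rw [← hmap, h, Submodule.map_bot]
  · right
    rw [← hmap, h, Submodule.map_top, LinearEquiv.range]

/-- The twist of a representation by a linear character. -/
def Representation.twist {k G V : Type*} [Field k] [Monoid G] [AddCommGroup V] [Module k V]
    (ρ : Representation k G V) (χ : G →* k) : Representation k G V where
  toFun g := χ g • ρ g
  map_one' := by simp
  map_mul' a b := by rw [map_mul, map_mul, smul_mul_smul_comm]

theorem Representation.IsIrreducible.twist {k G V : Type*} [Field k] [Group G] [AddCommGroup V]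
    [Module k V] {ρ : Representation k G V} (hρ : ρ.IsIrreducible) (χ : G →* k) :
    (ρ.twist χ).IsIrreducible := by
  rw [Representation.isIrreducible_iff_invariant] at hρ ⊢
  refine ⟨hρ.1, fun p hp => hρ.2 p fun g v hv => ?_⟩
  have h0 : χ g ≠ 0 := ((Group.isUnit g).map χ).ne_zero
  exact (p.smul_mem_iff h0).1 (hp g v hv)

/-- By Maschke the group algebra is a sum of simple left ideals. If `g` fixed each of them
pointwise, it would fix `1`. -/
theorem exists_isIrreducible_apply_ne_one {G : Type*} [Group G] [Finite G] {g : G} (hg : g ≠ 1) :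
    ∃ (n : ℕ) (ρ : Representation ℂ G (Fin n → ℂ)), ρ.IsIrreducible ∧ ρ g ≠ 1 := by
  classical
  open scoped MonoidAlgebra in
  have : Fintype G := Fintype.ofFinite G
  have hne : (MonoidAlgebra.of ℂ G g) ≠ 1 := fun h =>
    hg (MonoidAlgebra.of_injective (R := ℂ) (by rw [h, map_one]))
  obtain ⟨S, hS, x, hx, hgx⟩ : ∃ S : Submodule ℂ[G] ℂ[G], IsSimpleModule ℂ[G] S ∧
      ∃ x ∈ S, MonoidAlgebra.of ℂ G g * x ≠ x := by
    by_contra! hcon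
    apply hne
    have htop := IsSemisimpleModule.sSup_simples_eq_top ℂ[G] ℂ[G]
    have : (1 : ℂ[G]) ∈ sSup { m : Submodule ℂ[G] ℂ[G] | IsSimpleModule ℂ[G] m } := by
      rw [htop]; trivial
    rw [sSup_eq_iSup'] at this
    have h1 := Submodule.iSup_induction _
      (motive := fun x => MonoidAlgebra.of ℂ G g * x = x) this
      (fun S x hx => hcon S.1 S.2 x hx) (mul_zero _) (fun x y hx hy => by rw [mul_add, hx, hy])
    simpa using h1
  have : Module.Finite ℂ ℂ[G] := inferInstance
  let W : Submodule ℂ ℂ[G] := S.restrictScalars ℂ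
  let e : W ≃ₗ[ℂ] (Fin (Module.finrank ℂ W) → ℂ) := (Module.finBasis ℂ W).equivFun
  let τ : Representation ℂ G W :=
    { toFun := fun h => ((LinearMap.mulLeft ℂ (MonoidAlgebra.of ℂ G h)).restrict
        (fun x hx => S.smul_mem (MonoidAlgebra.of ℂ G h) hx))
      map_one' := by ext; simp
      map_mul' := fun a b => by ext; simp [mul_assoc] }
  have hτ : τ.IsIrreducible := by
    rw [Representation.isIrreducible_iff_invariant]
    refine ⟨IsSimpleModule.nontrivial ℂ[G] S, fun p hp => ?_⟩
    -- A `G`-stable complex subspace is a `ℂ[G]`-submodule, so simplicity of `S` applies to it.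
    let q : Submodule ℂ[G] S :=
      { carrier := {s | (s : W) ∈ p}
        add_mem' := fun ha hb => p.add_mem ha hb
        zero_mem' := p.zero_mem
        smul_mem' := fun c s hs => by
          induction c using MonoidAlgebra.induction_on with
          | of h => exact hp h s hs
          | add a b ha hb => rw [add_smul]; exact p.add_mem ha hb
          | smul r a ha => rw [smul_assoc]; exact p.smul_mem r ha }
    rcases eq_bot_or_eq_top q with h | h
    · refine Or.inl (eq_bot_iff.2 fun s hs => ?_)
      have : (s : S) ∈ q := hs
      rw [h] at this
      exact this
    · refine Or.inr (eq_top_iff.2 fun s _ => ?_)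
      have : (s : S) ∈ q := by rw [h]; trivial
      exact this
  refine ⟨_, e.conjRingEquiv.toMonoidHom.comp τ, hτ.conj e, fun h => hgx ?_⟩
  have h1 : τ g = 1 := e.conjRingEquiv.injective (by rw [map_one]; exact h)
  exact congrArg Subtype.val (LinearMap.congr_fun h1 ⟨x, hx⟩)

-- Suppose the representation `σ` moving `g` is linear. A `τ` that moves some commutator is
-- nonlinear; if `τ` fixes `g`, its twist by `σ` is still nonlinear and acts at `g` as the scalar `σ
-- g ≠ 1`.
open scoped commutatorElement in
theorem Representation.exists_isIrreducible_ne_one_apply_ne_one {G : Type*} [Group G] [Finite G]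
    (hG : commutator G ≠ ⊥) {g : G} (hg : g ≠ 1) :
    ∃ (n : ℕ) (ρ : Representation ℂ G (Fin n → ℂ)), ρ.IsIrreducible ∧ n ≠ 1 ∧ ρ g ≠ 1 := by
  obtain ⟨m, σ, hσ, hσg⟩ := exists_isIrreducible_apply_ne_one hg
  by_cases hm : m = 1
  · subst hm
    obtain ⟨a, b, hab⟩ : ∃ a b : G, ⁅a, b⁆ ≠ 1 := by
      by_contra! h
      exact hG (Subgroup.commutator_eq_bot_iff_le_centralizer.2 fun a _ =>
        Subgroup.mem_centralizer_iff.2 fun b _ => commutatorElement_eq_one_iff_mul_comm.1 (h b a))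
    obtain ⟨n, τ, hτ, hτab⟩ := exists_isIrreducible_apply_ne_one hab
    have hn : n ≠ 1 := by
      rintro rfl
      refine hτab ?_
      have hcomm : ∀ u v : Module.End ℂ (Fin 1 → ℂ), u * v = v * u := fun u v => by
        apply LinearMap.toMatrixAlgEquiv'.injective
        rw [map_mul, map_mul]
        ext i j
        fin_cases i; fin_cases j
        simp [Matrix.mul_apply, mul_comm]
      rw [commutatorElement_def, map_mul, map_mul, map_mul, hcomm (τ a) (τ b), ← map_mul,
        ← map_mul, ← map_mul]
      simp
    by_cases hτg : τ g = 1
    -- On a one-dimensional space the determinant turns `σ` into a scalar-valued homomorphism.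
    · refine ⟨n, τ.twist (LinearMap.det.comp σ), hτ.twist _, hn, fun h => hσg ?_⟩
      have hV := ((isIrreducible_iff_invariant τ).1 hτ).1
      obtain ⟨v, hv⟩ := exists_ne (0 : Fin n → ℂ)
      have h1 : LinearMap.det (σ g) • v = v := by
        have := LinearMap.congr_fun h v
        simpa [twist, hτg] using this
      have h2 : LinearMap.det (σ g) = 1 :=
        smul_left_injective ℂ hv (by simpa using h1)
      apply LinearMap.toMatrixAlgEquiv'.injective
      rw [← LinearMap.det_toMatrix', Matrix.det_fin_one] at h2
      rw [map_one]
      ext i j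
      fin_cases i; fin_cases j
      exact h2
    · exact ⟨n, τ, hτ, hn, hτg⟩
  · exact ⟨m, σ, hσ, hm, hσg⟩

/-! ### From character kernels to normal subgroups. -/

/-- A normal subgroup not containing the derived subgroup is the intersection of the kernels of the
nonlinear irreducible characters above it. -/
theorem exists_mem_nlKern_notMem {G : Type*} [Group G] [Finite G] {N : Subgroup G} [N.Normal]
    (hN : ¬ commutator G ≤ N) {g : G} (hg : g ∉ N) :
    ∃ K ∈ nlKern G, (N : Set G) ⊆ K ∧ g ∉ K := by
  have hH : commutator (G ⧸ N) ≠ ⊥ := by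
    intro h
    refine hN ?_
    have h1 := Subgroup.map_commutator (⊤ : Subgroup G) ⊤ (QuotientGroup.mk' N)
    rw [Subgroup.map_top_of_surjective _ (QuotientGroup.mk'_surjective N)] at h1
    have h2 : (commutator G).map (QuotientGroup.mk' N) = ⊥ := h1.trans h
    rwa [Subgroup.map_eq_bot_iff, QuotientGroup.ker_mk'] at h2
  have hg' : (QuotientGroup.mk g : G ⧸ N) ≠ 1 := fun h => hg ((QuotientGroup.eq_one_iff g).1 h)
  obtain ⟨n, ρ, hρ, hn, hρg⟩ := Representation.exists_isIrreducible_ne_one_apply_ne_one hH hg'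
  let σ : Representation ℂ G (Fin n → ℂ) := MonoidHom.comp ρ (QuotientGroup.mk' N)
  have hσ : σ.IsIrreducible := by
    rw [Representation.isIrreducible_iff_invariant] at hρ ⊢
    refine ⟨hρ.1, fun p hp => hρ.2 p fun h => ?_⟩
    induction h using QuotientGroup.induction_on with
    | H g => exact hp g
  refine ⟨charKer σ.character, ⟨_, ⟨n, σ, hσ, rfl⟩, ?_, rfl⟩, ?_, ?_⟩
  · rw [Representation.char_one]
    simpa using hn
  · rw [charKer_character]
    intro x hx
    change ρ (QuotientGroup.mk x) = 1
    rw [(QuotientGroup.eq_one_iff x).2 hx, map_one]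
  · rw [charKer_character]
    exact hρg

/-- The kernel of a nonlinear irreducible character is a normal subgroup not containing the derived
subgroup. -/
theorem exists_normal_of_mem_nlKern {G : Type*} [Group G] [Finite G] {K : Set G}
    (hK : K ∈ nlKern G) : ∃ N : Subgroup G, N.Normal ∧ ¬ commutator G ≤ N ∧ K = N := by
  obtain ⟨_, ⟨n, ρ, hρ, rfl⟩, hn, rfl⟩ := hK
  refine ⟨MonoidHom.ker ρ, MonoidHom.normal_ker ρ, fun h => hn ?_, charKer_character ρ⟩
  rw [Representation.char_one, hρ.finrank_eq_one_of_commutator_le_ker h, Nat.cast_one]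

/-- The kernels of the nonlinear irreducible characters form a chain if and only if the normal
subgroups not containing the derived subgroup do. -/
theorem isChain_nlKern_iff {G : Type*} [Group G] [Finite G] :
    IsChain (· ⊆ ·) (nlKern G) ↔ ∀ N₁ N₂ : Subgroup G, N₁.Normal → N₂.Normal →
      ¬ commutator G ≤ N₁ → ¬ commutator G ≤ N₂ → N₁ ≤ N₂ ∨ N₂ ≤ N₁ := by
  constructor
  · intro h N₁ N₂ _ _ h₁ h₂
    by_contra! hcon
    obtain ⟨x, hx₁, hx₂⟩ := SetLike.not_le_iff_exists.1 hcon.1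
    obtain ⟨y, hy₂, hy₁⟩ := SetLike.not_le_iff_exists.1 hcon.2
    -- `K₁` contains `x` but not `y`, and `K₂` contains `y` but not `x`, so neither contains the
    -- other.
    obtain ⟨K₁, hK₁, hN₁, hyK⟩ := exists_mem_nlKern_notMem h₁ hy₁
    obtain ⟨K₂, hK₂, hN₂, hxK⟩ := exists_mem_nlKern_notMem h₂ hx₂
    rcases h.total hK₁ hK₂ with hle | hle
    · exact hxK (hle (hN₁ hx₁))
    · exact hyK (hle (hN₂ hy₂))
  · intro h K₁ hK₁ K₂ hK₂ _
    obtain ⟨N₁, hn₁, hc₁, rfl⟩ := exists_normal_of_mem_nlKern hK₁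
    obtain ⟨N₂, hn₂, hc₂, rfl⟩ := exists_normal_of_mem_nlKern hK₂
    exact h N₁ N₂ hn₁ hn₂ hc₁ hc₂

/-! ### Minimal normal subgroups and central `q`-subgroups. -/

theorem IsMinimalNormal.eq_of_le {G : Type*} [Group G] {A B : Subgroup G} (hA : IsMinimalNormal A)
    (hB : IsMinimalNormal B) (h : A ≤ B) : A = B :=
  (hB.2.2 A hA.1 h).resolve_left hA.2.1

theorem IsMinimalNormal.zpowers {G : Type*} [Group G] {z : G} (hz : z ∈ Subgroup.center G)
    (hp : (orderOf z).Prime) : IsMinimalNormal (Subgroup.zpowers z) := by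
  refine ⟨⟨fun x hx g => ?_⟩, ?_, fun L _ hL => ?_⟩
  · have hx' : x ∈ Subgroup.center G := (Subgroup.zpowers_le.2 hz) hx
    rwa [Subgroup.mem_center_iff.1 hx' g, mul_inv_cancel_right]
  · intro h
    rw [Subgroup.zpowers_eq_bot] at h
    rw [h, orderOf_one] at hp
    exact Nat.not_prime_one hp
  · have : Fact (Nat.card (Subgroup.zpowers z)).Prime := ⟨by rwa [Nat.card_zpowers]⟩
    rcases (L.subgroupOf (Subgroup.zpowers z)).eq_bot_or_eq_top_of_prime_card with h | h
    · left
      rw [Subgroup.subgroupOf_eq_bot] at h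
      rw [eq_bot_iff]
      exact fun x hx => h.le_bot ⟨hx, hL hx⟩
    · right
      rw [Subgroup.subgroupOf_eq_top] at h
      exact le_antisymm hL h

/-- In an abelian `q`-group with a unique subgroup of order `q`, an element lies in every cyclic
subgroup whose order it divides. -/
theorem mem_zpowers_of_pow_dvd_orderOf {G : Type*} [Group G] {Y : Subgroup G}
    (hY : Y ≤ Subgroup.center G) {q : ℕ} (hq : q.Prime)
    (h : ∀ z ∈ Y, ∀ w ∈ Y, z ^ q = 1 → w ≠ 1 → z ∈ Subgroup.zpowers w) (k : ℕ) :
    ∀ x ∈ Y, ∀ y ∈ Y, x ^ q ^ k = 1 → q ^ k ∣ orderOf y → orderOf y ≠ 0 →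
      x ∈ Subgroup.zpowers y := by
  induction k with
  | zero =>
    intro x _ y _ hx1 _ _
    rw [pow_zero, pow_one] at hx1
    rw [hx1]; exact one_mem _
  | succ k ih =>
    intro x hx y hy hx1 hy1 hy0
    have hqy : q ∣ orderOf y := (dvd_pow_self q k.succ_ne_zero).trans hy1
    have hyq : orderOf (y ^ q) = orderOf y / q := by
      rw [orderOf_pow_of_dvd hq.ne_zero hqy]
    have hxq := ih (x ^ q) (Y.pow_mem hx q) (y ^ q) (Y.pow_mem hy q)
      (by rw [← pow_mul, ← pow_succ', hx1])
      (by rw [hyq]; exact (Nat.dvd_div_iff_mul_dvd hqy).2 (by rwa [← pow_succ']))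
      (by rw [hyq]; exact (Nat.div_pos (Nat.le_of_dvd (Nat.pos_of_ne_zero hy0) hqy) hq.pos).ne')
    -- Now `x ^ q = (y ^ j) ^ q`, so `x * (y ^ j)⁻¹` is killed by `q` and lies in `zpowers y` by
    -- `h`.
    obtain ⟨j, hj⟩ := Subgroup.mem_zpowers_iff.1 hxq
    have hcomm : Commute x (y ^ j)⁻¹ :=
      ((Subgroup.mem_center_iff.1 (hY hx)) (y ^ j)⁻¹).symm
    have h1 : (x * (y ^ j)⁻¹) ^ q = 1 := by
      rw [hcomm.mul_pow, ← hj, inv_pow, ← zpow_natCast, ← zpow_natCast, ← zpow_mul, ← zpow_mul,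
        mul_comm j, mul_inv_cancel]
    have hyne : y ≠ 1 := by
      rintro rfl
      rw [orderOf_one] at hqy
      exact hq.one_lt.ne' (Nat.dvd_one.1 hqy)
    have h2 := h _ (Y.mul_mem hx (Y.inv_mem (Y.zpow_mem hy j))) y hy h1 hyne
    have h3 := mul_mem h2 (Subgroup.zpow_mem_zpowers y j)
    rwa [inv_mul_cancel_right] at h3

/-- Given `x` in `X₁` only and `y` in `X₂` only, both orders are powers of `q`. One divides the
other, so one element is a power of the other. -/
theorem le_or_le_of_forall_mem_zpowers {G : Type*} [Group G] [Finite G] {Y X₁ X₂ : Subgroup G}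
    (hY : Y ≤ Subgroup.center G) {q : ℕ} (hq : q.Prime) (h1 : X₁ ≤ Y) (h2 : X₂ ≤ Y)
    (hYq : ∀ z ∈ Y, ∃ k, z ^ q ^ k = 1)
    (h : ∀ z ∈ Y, ∀ w ∈ Y, z ^ q = 1 → w ≠ 1 → z ∈ Subgroup.zpowers w) :
    X₁ ≤ X₂ ∨ X₂ ≤ X₁ := by
  have key : ∀ x ∈ Y, ∀ y ∈ Y, orderOf x ∣ orderOf y → x ∈ Subgroup.zpowers y := by
    intro x hx y hy hxy
    obtain ⟨k, hk⟩ := hYq x hx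
    obtain ⟨m, -, hm⟩ := (Nat.dvd_prime_pow hq).1 (orderOf_dvd_of_pow_eq_one hk)
    exact mem_zpowers_of_pow_dvd_orderOf hY hq h m x hx y hy (by rw [← hm, pow_orderOf_eq_one])
      (hm ▸ hxy) (orderOf_pos y).ne'
  by_contra! hcon
  obtain ⟨x, hx₁, hx₂⟩ := SetLike.not_le_iff_exists.1 hcon.1
  obtain ⟨y, hy₂, hy₁⟩ := SetLike.not_le_iff_exists.1 hcon.2
  obtain ⟨k, hk⟩ := hYq x (h1 hx₁)
  obtain ⟨a, -, ha⟩ := (Nat.dvd_prime_pow hq).1 (orderOf_dvd_of_pow_eq_one hk)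
  obtain ⟨l, hl⟩ := hYq y (h2 hy₂)
  obtain ⟨b, -, hb⟩ := (Nat.dvd_prime_pow hq).1 (orderOf_dvd_of_pow_eq_one hl)
  rcases le_total a b with hab | hab
  · exact hx₂ (Subgroup.zpowers_le.2 hy₂
      (key x (h1 hx₁) y (h2 hy₂) (by rw [ha, hb]; exact pow_dvd_pow q hab)))
  · exact hy₁ (Subgroup.zpowers_le.2 hx₁
      (key y (h2 hy₂) x (h1 hx₁) (by rw [ha, hb]; exact pow_dvd_pow q hab)))

-- A commutator `⁅g, x⁆` with `x ∈ X` lies in both `X` and `G'`.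
open scoped commutatorElement in
theorem le_center_of_inf_commutator_eq_bot {G : Type*} [Group G] {X : Subgroup G}
    (hX : X.Normal) (h : X ⊓ commutator G = ⊥) : X ≤ Subgroup.center G := by
  intro x hx
  rw [Subgroup.mem_center_iff]
  intro g
  have h1 : ⁅g, x⁆ ∈ X ⊓ commutator G :=
    ⟨X.mul_mem (hX.conj_mem x hx g) (X.inv_mem hx),
      Subgroup.commutator_mem_commutator (Subgroup.mem_top g) (Subgroup.mem_top x)⟩
  rw [h, Subgroup.mem_bot] at h1
  exact commutatorElement_eq_one_iff_mul_comm.1 h1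

/-- If the derived subgroup is a minimal normal subgroup and there is at most one other, then the
normal subgroups meeting the derived subgroup trivially form a chain. -/
theorem le_or_le_of_inf_commutator_eq_bot {G : Type*} [Group G] [Finite G]
    (hD : IsMinimalNormal (commutator G))
    (hcard : {N : Subgroup G | IsMinimalNormal N}.encard ≤ 2) {X₁ X₂ : Subgroup G}
    (hX₁ : X₁.Normal) (hX₂ : X₂.Normal) (h₁ : X₁ ⊓ commutator G = ⊥)
    (h₂ : X₂ ⊓ commutator G = ⊥) : X₁ ≤ X₂ ∨ X₂ ≤ X₁ := by
  have huniq : ∀ A B : Subgroup G, IsMinimalNormal A → IsMinimalNormal B → A ≠ commutator G →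
      B ≠ commutator G → A = B := by
    intro A B hA hB hAD hBD
    by_contra hAB
    have hsub : ({commutator G, A, B} : Set (Subgroup G)) ⊆ {N | IsMinimalNormal N} := by
      rintro N (rfl | rfl | rfl) <;> assumption
    have h3 := (Set.encard_le_encard hsub).trans hcard
    rw [Set.encard_eq_three.2 ⟨_, _, _, hAD.symm, hBD.symm, hAB, rfl⟩] at h3
    exact absurd h3 (by decide)
  have hc₁ := le_center_of_inf_commutator_eq_bot hX₁ h₁
  have hc₂ := le_center_of_inf_commutator_eq_bot hX₂ h₂
  rcases eq_or_ne X₁ ⊥ with hb | hb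
  · exact Or.inl (hb ▸ bot_le)
  have hYc : X₁ ⊔ X₂ ≤ Subgroup.center G := sup_le hc₁ hc₂
  have hcne : Nat.card X₁ ≠ 1 := fun h => hb (Subgroup.card_eq_one.1 h)
  -- By `huniq`, a subgroup `zpowers x` of prime order `q` in `X₁` will be the only minimal normal
  -- subgroup besides `G'`.
  obtain ⟨q, hq, hqd⟩ := Nat.exists_prime_and_dvd hcne
  have : Fact q.Prime := ⟨hq⟩
  obtain ⟨⟨x, hx⟩, hxq⟩ := exists_prime_orderOf_dvd_card' q hqd
  rw [Subgroup.orderOf_mk] at hxq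
  have hN : IsMinimalNormal (Subgroup.zpowers x) := .zpowers (hc₁ hx) (hxq ▸ hq)
  have hND : ∀ X : Subgroup G, X ⊓ commutator G = ⊥ → ∀ z ∈ X,
      Subgroup.zpowers z = commutator G → z = 1 := by
    intro X hX z hz h
    have h1 : z ∈ X ⊓ commutator G := ⟨hz, h ▸ Subgroup.mem_zpowers z⟩
    rwa [hX] at h1
  have hx1 : x ≠ 1 := by
    rintro rfl
    rw [orderOf_one] at hxq
    exact hq.one_lt.ne hxq
  have hNne : Subgroup.zpowers x ≠ commutator G := fun h => hx1 (hND X₁ h₁ x hx h)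
  -- Any prime `r` dividing the order of `z` gives a minimal normal subgroup of order `r` other than
  -- `G'`; it must be `zpowers x`, so `r = q`.
  have hpow : ∀ X : Subgroup G, X ≤ Subgroup.center G → X ⊓ commutator G = ⊥ → ∀ z ∈ X,
      ∃ k, z ^ q ^ k = 1 := by
    intro X hXc hX z hz
    refine ⟨(orderOf z).primeFactorsList.length, ?_⟩
    have : orderOf z = q ^ (orderOf z).primeFactorsList.length := by
      refine Nat.eq_prime_pow_of_unique_prime_dvd (orderOf_pos z).ne' fun {r} hr hrz => ?_
      have hord : orderOf (z ^ (orderOf z / r)) = r :=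
        orderOf_pow_orderOf_div (orderOf_pos z).ne' hrz
      have hmem : z ^ (orderOf z / r) ∈ X := X.pow_mem hz _
      have hmin : IsMinimalNormal (Subgroup.zpowers (z ^ (orderOf z / r))) :=
        .zpowers (hXc hmem) (hord.symm ▸ hr)
      have heq := huniq _ _ hmin hN (fun h => by
        have := hND X hX _ hmem h
        rw [this, orderOf_one] at hord
        exact hr.one_lt.ne hord) hNne
      rw [← hord, ← hxq, ← Nat.card_zpowers, heq, Nat.card_zpowers]
    rw [← this, pow_orderOf_eq_one]
  have hYq : ∀ z ∈ X₁ ⊔ X₂, ∃ k, z ^ q ^ k = 1 := by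
    intro z hz
    obtain ⟨a, ha, b, hb, rfl⟩ := Subgroup.mem_sup_of_normal_left.1 hz
    obtain ⟨k, hk⟩ := hpow X₁ hc₁ h₁ a ha
    obtain ⟨l, hl⟩ := hpow X₂ hc₂ h₂ b hb
    have hcomm : Commute a b := (Subgroup.mem_center_iff.1 (hc₁ ha) b).symm
    exact ⟨k + l, by rw [hcomm.mul_pow, pow_add, pow_mul, hk, one_pow, mul_comm, pow_mul, hl,
      one_pow, one_mul]⟩
  have hprime : ∀ z ∈ X₁ ⊔ X₂, orderOf z = q → Subgroup.zpowers z = Subgroup.zpowers x := by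
    intro z hz hzq
    have hzm : IsMinimalNormal (Subgroup.zpowers z) := .zpowers (hYc hz) (hzq ▸ hq)
    by_contra hne
    -- The product of `X₁` and `X₂` may meet `G'` although neither factor does. If `zpowers z = G'`,
    -- then `x * z` has order `q` and lies outside `G'`, so it generates `zpowers x`. Hence `z ∈ X₁
    -- ⊓ G' = ⊥`, a contradiction.
    have hzD : Subgroup.zpowers z = commutator G := by
      by_contra h
      exact hne (huniq _ _ hzm hN h hNne)
    have hz1 : z ≠ 1 := by
      rintro rfl
      rw [orderOf_one] at hzq
      exact hq.one_lt.ne hzq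
    have hcomm : Commute x z := (Subgroup.mem_center_iff.1 (hc₁ hx) z).symm
    have hxzD : x * z ∉ commutator G := by
      intro h
      refine hx1 ((Subgroup.mem_bot).1 (h₁ ▸ ⟨hx, ?_⟩ : x ∈ (⊥ : Subgroup G)))
      exact (Subgroup.mul_mem_cancel_right _ (hzD ▸ Subgroup.mem_zpowers z)).1 h
    have hxz1 : x * z ≠ 1 := fun h => hxzD (h ▸ one_mem _)
    have hord : orderOf (x * z) = q :=
      orderOf_eq_prime (by rw [hcomm.mul_pow, ← hxq, pow_orderOf_eq_one, hxq, ← hzq,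
        pow_orderOf_eq_one, one_mul]) hxz1
    have hxzm : IsMinimalNormal (Subgroup.zpowers (x * z)) :=
      .zpowers (mul_mem (hc₁ hx) (hYc hz)) (hord ▸ hq)
    have heq := huniq _ _ hxzm hN (fun h => hxzD (h ▸ Subgroup.mem_zpowers _)) hNne
    have hxz : x * z ∈ Subgroup.zpowers x := heq ▸ Subgroup.mem_zpowers _
    have hzx : z ∈ X₁ := Subgroup.zpowers_le.2 hx
      ((Subgroup.mul_mem_cancel_left _ (Subgroup.mem_zpowers x)).1 hxz)
    exact hz1 (hND X₁ h₁ z hzx hzD)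
  refine le_or_le_of_forall_mem_zpowers hYc hq le_sup_left le_sup_right hYq ?_
  intro z hz w hw hzq hw1
  rcases eq_or_ne z 1 with rfl | hz1
  · exact one_mem _
  obtain ⟨k, hk⟩ := hYq w hw
  obtain ⟨m, -, hm⟩ := (Nat.dvd_prime_pow hq).1 (orderOf_dvd_of_pow_eq_one hk)
  have hqw : q ∣ orderOf w := by
    rw [hm]
    refine dvd_pow_self q ?_
    rintro rfl
    exact hw1 (orderOf_eq_one_iff.1 hm)
  have hw' : orderOf (w ^ (orderOf w / q)) = q := orderOf_pow_orderOf_div (orderOf_pos w).ne' hqw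
  have h1 := hprime _ (Subgroup.pow_mem _ hw (orderOf w / q)) hw'
  have h2 := hprime z hz (orderOf_eq_prime hzq hz1)
  have h3 : z ∈ Subgroup.zpowers (w ^ (orderOf w / q)) := by
    rw [h1, ← h2]; exact Subgroup.mem_zpowers z
  exact Subgroup.zpowers_le.2 (Subgroup.npow_mem_zpowers w _) h3

/-! ### Chief factors and minimal normal subgroups of quotients. -/

theorem IsChiefFactor.isMinimalNormal_map_mk {G : Type*} [Group G] {H M : Subgroup G} [M.Normal]
    (h : IsChiefFactor H M) : IsMinimalNormal (H.map (QuotientGroup.mk' M)) := by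
  obtain ⟨hH, -, hMH, hmax⟩ := h
  refine ⟨hH.map _ (QuotientGroup.mk'_surjective M), fun h => ?_, fun L hL hLH => ?_⟩
  · rw [Subgroup.map_eq_bot_iff, QuotientGroup.ker_mk'] at h
    exact hMH.not_ge h
  · have h1 : M ≤ L.comap (QuotientGroup.mk' M) := by
      exact (QuotientGroup.ker_mk' M).ge.trans (Subgroup.ker_le_comap _ _)
    have h2 : L.comap (QuotientGroup.mk' M) ≤ H := by
      refine (Subgroup.comap_mono hLH).trans ?_
      rw [Subgroup.comap_map_eq, QuotientGroup.ker_mk']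
      exact sup_le le_rfl hMH.le
    have h3 : (L.comap (QuotientGroup.mk' M)).map (QuotientGroup.mk' M) = L :=
      Subgroup.map_comap_eq_self_of_surjective (QuotientGroup.mk'_surjective M) L
    rcases hmax _ (hL.comap _) h1 h2 with h | h
    · left
      rw [← h3, h, Subgroup.map_eq_bot_iff, QuotientGroup.ker_mk']
    · right
      rw [← h3, h]

theorem IsMinimalNormal.isChiefFactor_comap_mk {G : Type*} [Group G] {M : Subgroup G} [M.Normal]
    {N : Subgroup (G ⧸ M)} (h : IsMinimalNormal N) :
    IsChiefFactor (N.comap (QuotientGroup.mk' M)) M := by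
  obtain ⟨hN, hne, hmin⟩ := h
  have h3 : (N.comap (QuotientGroup.mk' M)).map (QuotientGroup.mk' M) = N :=
    Subgroup.map_comap_eq_self_of_surjective (QuotientGroup.mk'_surjective M) N
  have hle : M ≤ N.comap (QuotientGroup.mk' M) := by
    exact (QuotientGroup.ker_mk' M).ge.trans (Subgroup.ker_le_comap _ _)
  refine ⟨hN.comap _, inferInstance, lt_of_le_of_ne hle fun h => hne ?_, fun L hL h1 h2 => ?_⟩
  · rw [← h3, ← h, Subgroup.map_eq_bot_iff, QuotientGroup.ker_mk']
  · have h4 : (L.map (QuotientGroup.mk' M)).comap (QuotientGroup.mk' M) = L := by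
      rw [Subgroup.comap_map_eq, QuotientGroup.ker_mk', sup_eq_left.2 h1]
    rcases hmin _ (hL.map _ (QuotientGroup.mk'_surjective M))
        (Subgroup.map_le_iff_le_comap.2 h2) with h | h
    · left
      rw [Subgroup.map_eq_bot_iff, QuotientGroup.ker_mk'] at h
      exact le_antisymm h h1
    · right
      rw [← h4, h]

/-- Above a normal subgroup `M`, every strictly larger normal subgroup contains a chief factor. -/
theorem exists_isChiefFactor_le {G : Type*} [Group G] [Finite G] {M X : Subgroup G}
    (hM : M.Normal) (hX : X.Normal) (h : M < X) : ∃ N ≤ X, IsChiefFactor N M := by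
  obtain ⟨N, hNX, hN⟩ := (Set.toFinite {N : Subgroup G | N.Normal ∧ M < N}).exists_le_minimal
    ⟨hX, h⟩
  refine ⟨N, hNX, hN.prop.1, hM, hN.prop.2, fun L hL h1 h2 => ?_⟩
  rcases h1.eq_or_lt with h3 | h3
  · exact Or.inl h3.symm
  · exact Or.inr (le_antisymm h2 (hN.le_of_le ⟨hL, h3⟩ h2))

/-- Below a normal subgroup `H`, every strictly smaller normal subgroup lies in a chief factor. -/
theorem exists_le_isChiefFactor {G : Type*} [Group G] [Finite G] {H X : Subgroup G}
    (hH : H.Normal) (hX : X.Normal) (h : X < H) : ∃ N, X ≤ N ∧ IsChiefFactor H N := by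
  obtain ⟨N, hNX, hN⟩ := (Set.toFinite {N : Subgroup G | N.Normal ∧ N < H}).exists_le_maximal
    ⟨hX, h⟩
  refine ⟨N, hNX, hH, hN.prop.1, hN.prop.2, fun L hL h1 h2 => ?_⟩
  rcases h2.eq_or_lt with h3 | h3
  · exact Or.inr h3
  · exact Or.inl (le_antisymm (hN.le_of_ge ⟨hL, h3⟩ h1) h1)

theorem map_mk_commutator {G : Type*} [Group G] (M : Subgroup G) [M.Normal] :
    (commutator G).map (QuotientGroup.mk' M) = commutator (G ⧸ M) := by
  have h := Subgroup.map_commutator (⊤ : Subgroup G) ⊤ (QuotientGroup.mk' M)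
  rwa [Subgroup.map_top_of_surjective _ (QuotientGroup.mk'_surjective M)] at h

/-- If `G' / M` is a chief factor and `G / M` has at most two minimal normal subgroups, then the
normal subgroups meeting `G'` in `M` form a chain. -/
theorem IsChiefFactor.le_or_le_of_inf_commutator_eq {G : Type*} [Group G] [Finite G]
    {M : Subgroup G} [M.Normal] (hM : IsChiefFactor (commutator G) M)
    (hcard : {N : Subgroup (G ⧸ M) | IsMinimalNormal N}.encard ≤ 2) {X₁ X₂ : Subgroup G}
    (hX₁ : X₁.Normal) (hX₂ : X₂.Normal) (h₁ : X₁ ⊓ commutator G = M)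
    (h₂ : X₂ ⊓ commutator G = M) : X₁ ≤ X₂ ∨ X₂ ≤ X₁ := by
  have hcm : ∀ X : Subgroup G, X ⊓ commutator G = M →
      (X.map (QuotientGroup.mk' M)).comap (QuotientGroup.mk' M) = X := fun X hX => by
    rw [Subgroup.comap_map_eq, QuotientGroup.ker_mk', sup_eq_left]
    exact hX ▸ inf_le_left
  have hinf : ∀ X : Subgroup G, X ⊓ commutator G = M →
      X.map (QuotientGroup.mk' M) ⊓ commutator (G ⧸ M) = ⊥ := fun X hX => by
    have h4 : (commutator (G ⧸ M)).comap (QuotientGroup.mk' M) = commutator G := by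
      rw [← map_mk_commutator, Subgroup.comap_map_eq, QuotientGroup.ker_mk',
        sup_eq_left.2 hM.2.2.1.le]
    rw [← Subgroup.map_comap_eq_self_of_surjective (QuotientGroup.mk'_surjective M)
      (X.map (QuotientGroup.mk' M) ⊓ commutator (G ⧸ M)), Subgroup.comap_inf, hcm X hX, h4, hX,
      Subgroup.map_eq_bot_iff, QuotientGroup.ker_mk']
  have hD := hM.isMinimalNormal_map_mk
  rw [map_mk_commutator] at hD
  rw [← hcm X₁ h₁, ← hcm X₂ h₂]
  exact (le_or_le_of_inf_commutator_eq_bot hD hcard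
    (hX₁.map _ (QuotientGroup.mk'_surjective M)) (hX₂.map _ (QuotientGroup.mk'_surjective M))
    (hinf X₁ h₁) (hinf X₂ h₂)).imp (fun h => Subgroup.comap_mono h) (fun h => Subgroup.comap_mono h)

/-! ### The chain condition compared with conditions (2) and (3). -/

section Chain

variable {G : Type*} [Group G]

/-- A minimal normal subgroup of `G/M` other than `G'/M` does not contain `G'/M`. The preimages of
two such are therefore comparable, and minimality makes them equal. -/
theorem encard_minimalNormal_le_two_of_chain
    (h : ∀ N₁ N₂ : Subgroup G, N₁.Normal → N₂.Normal →
      ¬ commutator G ≤ N₁ → ¬ commutator G ≤ N₂ → N₁ ≤ N₂ ∨ N₂ ≤ N₁)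
    (M : Subgroup G) [M.Normal] (hM : IsChiefFactor (commutator G) M) :
    {N : Subgroup (G ⧸ M) | IsMinimalNormal N}.encard ≤ 2 := by
  have hD := hM.isMinimalNormal_map_mk
  have hnot : ∀ N : Subgroup (G ⧸ M), IsMinimalNormal N →
      N ≠ (commutator G).map (QuotientGroup.mk' M) →
      ¬ commutator G ≤ N.comap (QuotientGroup.mk' M) := fun N hN hne hle =>
    hne (hD.eq_of_le hN (Subgroup.map_le_iff_le_comap.2 hle)).symm
  have huniq : ∀ A B : Subgroup (G ⧸ M), IsMinimalNormal A → IsMinimalNormal B →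
      A ≠ (commutator G).map (QuotientGroup.mk' M) →
      B ≠ (commutator G).map (QuotientGroup.mk' M) → A = B := by
    intro A B hA hB hA' hB'
    rcases h _ _ (hA.1.comap _) (hB.1.comap _) (hnot A hA hA') (hnot B hB hB') with hle | hle
    · exact hA.eq_of_le hB
        ((Subgroup.comap_le_comap_of_surjective (QuotientGroup.mk'_surjective M)).1 hle)
    · exact (hB.eq_of_le hA
        ((Subgroup.comap_le_comap_of_surjective (QuotientGroup.mk'_surjective M)).1 hle)).symm
  by_cases hex : ∃ A, IsMinimalNormal A ∧ A ≠ (commutator G).map (QuotientGroup.mk' M)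
  · obtain ⟨A, hA, hA'⟩ := hex
    refine (Set.encard_le_encard (t := {(commutator G).map (QuotientGroup.mk' M), A})
      fun B hB => ?_).trans
        ((Set.encard_insert_le _ _).trans (by rw [Set.encard_singleton, one_add_one_eq_two]))
    by_cases hB' : B = (commutator G).map (QuotientGroup.mk' M)
    · exact Or.inl hB'
    · exact Or.inr (huniq B A hB hA hB' hA')
  · push Not at hex
    refine (Set.encard_le_encard (t := {(commutator G).map (QuotientGroup.mk' M)})
      fun B hB => hex B hB).trans ?_
    rw [Set.encard_singleton]
    exact one_le_two

/-- Here no minimal normal subgroup of `G/M` contains `G'/M`: it would equal `G'/M`, making `G'/M`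
chief. So all of them have comparable preimages. -/
theorem existsUnique_minimalNormal_of_chain [Finite G]
    (h : ∀ N₁ N₂ : Subgroup G, N₁.Normal → N₂.Normal →
      ¬ commutator G ≤ N₁ → ¬ commutator G ≤ N₂ → N₁ ≤ N₂ ∨ N₂ ≤ N₁)
    (M : Subgroup G) [M.Normal] (hlt : M < commutator G)
    (hM : ¬ IsChiefFactor (commutator G) M) :
    ∃! N : Subgroup (G ⧸ M), IsMinimalNormal N := by
  have hnot : ∀ N : Subgroup (G ⧸ M), IsMinimalNormal N →
      ¬ commutator G ≤ N.comap (QuotientGroup.mk' M) := fun N hN hle => by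
    have hN' := hN.isChiefFactor_comap_mk
    rcases hN'.2.2.2 (commutator G) inferInstance hlt.le hle with h1 | h1
    · exact hlt.ne' h1
    · exact hM (h1 ▸ hN')
  obtain ⟨N, -, hN⟩ := exists_isChiefFactor_le (M := M) inferInstance inferInstance hlt
  refine ⟨_, hN.isMinimalNormal_map_mk, fun B hB => ?_⟩
  have hA := hN.isMinimalNormal_map_mk
  rcases h _ _ (hA.1.comap _) (hB.1.comap _) (hnot _ hA) (hnot B hB) with hle | hle
  · exact (hA.eq_of_le hB
      ((Subgroup.comap_le_comap_of_surjective (QuotientGroup.mk'_surjective M)).1 hle)).symm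
  · exact hB.eq_of_le hA
      ((Subgroup.comap_le_comap_of_surjective (QuotientGroup.mk'_surjective M)).1 hle)

/-- Apply the hypothesis to `M = N₁ ⊓ N₂ ⊓ G'`. If `G/M` has a unique minimal normal subgroup and
`N₁`, `N₂` are incomparable, its preimage lies in `N₁`, `N₂` and `G'`, hence in `M`, which is
absurd. If `G'/M` is chief, both `Nᵢ` meet `G'` exactly in `M`. -/
theorem chain_of_minimalNormal [Finite G]
    (h : ∀ (M : Subgroup G) [M.Normal], M < commutator G →
      (¬ IsChiefFactor (commutator G) M ∧ ∃! N : Subgroup (G ⧸ M), IsMinimalNormal N) ∨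
      (IsChiefFactor (commutator G) M ∧
        {N : Subgroup (G ⧸ M) | IsMinimalNormal N}.encard ≤ 2))
    {N₁ N₂ : Subgroup G} (hN₁ : N₁.Normal) (hN₂ : N₂.Normal) (h₁ : ¬ commutator G ≤ N₁)
    (h₂ : ¬ commutator G ≤ N₂) : N₁ ≤ N₂ ∨ N₂ ≤ N₁ := by
  have hlt : N₁ ⊓ N₂ ⊓ commutator G < commutator G :=
    lt_of_le_of_ne inf_le_right fun e => h₁ (e ▸ inf_le_left.trans inf_le_left)
  rcases h (N₁ ⊓ N₂ ⊓ commutator G) hlt with ⟨-, A, -, hA⟩ | ⟨hch, hcard⟩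
  · by_contra! hcon
    have hle : ∀ X : Subgroup G, X.Normal → N₁ ⊓ N₂ ⊓ commutator G < X →
        A.comap (QuotientGroup.mk' (N₁ ⊓ N₂ ⊓ commutator G)) ≤ X := by
      intro X hX hlt'
      obtain ⟨N, hNX, hN⟩ := exists_isChiefFactor_le inferInstance hX hlt'
      rw [← hA _ hN.isMinimalNormal_map_mk, Subgroup.comap_map_eq, QuotientGroup.ker_mk']
      exact sup_le hNX hlt'.le
    have hl₁ : N₁ ⊓ N₂ ⊓ commutator G < N₁ := lt_of_le_of_ne (inf_le_left.trans inf_le_left)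
      fun e => hcon.1 (e ▸ inf_le_left.trans inf_le_right)
    have hl₂ : N₁ ⊓ N₂ ⊓ commutator G < N₂ := lt_of_le_of_ne (inf_le_left.trans inf_le_right)
      fun e => hcon.2 (e ▸ inf_le_left.trans inf_le_left)
    obtain ⟨N, -, hN⟩ := exists_isChiefFactor_le (M := N₁ ⊓ N₂ ⊓ commutator G)
      inferInstance inferInstance hlt
    have hAle := le_inf (le_inf (hle N₁ hN₁ hl₁) (hle N₂ hN₂ hl₂))
      (hle (commutator G) inferInstance hlt)
    rw [← hA _ hN.isMinimalNormal_map_mk, Subgroup.comap_map_eq, QuotientGroup.ker_mk'] at hAle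
    exact hN.2.2.1.not_ge (le_sup_left.trans hAle)
  · have hinf : ∀ X : Subgroup G, X.Normal → ¬ commutator G ≤ X → N₁ ⊓ N₂ ≤ X →
        X ⊓ commutator G = N₁ ⊓ N₂ ⊓ commutator G := fun X hX hne hle =>
      (hch.2.2.2 (X ⊓ commutator G) inferInstance (inf_le_inf_right _ hle)
        inf_le_right).resolve_right fun e => hne (e ▸ inf_le_left)
    exact hch.le_or_le_of_inf_commutator_eq hcard hN₁ hN₂ (hinf N₁ hN₁ h₁ inf_le_left)
      (hinf N₂ hN₂ h₂ inf_le_right)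

/-- An `Nᵢ` properly inside `G'` is a waist. If neither is, the waist `M` lies below both, and
chiefness of `G'/M` gives `Nᵢ ⊓ G' = M`. -/
theorem chain_of_waist [Finite G]
    (hw : ∀ M : Subgroup G, M.Normal → M < commutator G → IsWaist M)
    (hu : ∃! M : Subgroup G, IsChiefFactor (commutator G) M)
    (hcard : ∀ (M : Subgroup G) [M.Normal], IsChiefFactor (commutator G) M →
      {N : Subgroup (G ⧸ M) | IsMinimalNormal N}.encard ≤ 2)
    {N₁ N₂ : Subgroup G} (hN₁ : N₁.Normal) (hN₂ : N₂.Normal) (h₁ : ¬ commutator G ≤ N₁)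
    (h₂ : ¬ commutator G ≤ N₂) : N₁ ≤ N₂ ∨ N₂ ≤ N₁ := by
  obtain ⟨M, hM, hMu⟩ := hu
  have hMn : M.Normal := hM.2.1
  have hlt := hM.2.2.1
  by_cases hl₁ : N₁ < commutator G
  · exact (hw N₁ hN₁ hl₁).2 N₂ hN₂ |>.symm
  by_cases hl₂ : N₂ < commutator G
  · exact (hw N₂ hN₂ hl₂).2 N₁ hN₁
  have hinf : ∀ X : Subgroup G, X.Normal → ¬ commutator G ≤ X → ¬ X < commutator G →
      X ⊓ commutator G = M := by
    intro X hX hne hnlt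
    have hMX : M ≤ X := by
      rcases (hw M hMn hlt).2 X hX with h | h
      · exact absurd (h.trans_lt hlt) hnlt
      · exact h
    exact (hM.2.2.2 (X ⊓ commutator G) inferInstance (le_inf hMX hlt.le)
      inf_le_right).resolve_right fun e => hne (e ▸ inf_le_left)
  exact hM.le_or_le_of_inf_commutator_eq (hcard M hM) hN₁ hN₂ (hinf N₁ hN₁ h₁ hl₁)
    (hinf N₂ hN₂ h₂ hl₂)

theorem isWaist_of_chain
    (h : ∀ N₁ N₂ : Subgroup G, N₁.Normal → N₂.Normal →
      ¬ commutator G ≤ N₁ → ¬ commutator G ≤ N₂ → N₁ ≤ N₂ ∨ N₂ ≤ N₁)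
    {M : Subgroup G} (hM : M.Normal) (hlt : M < commutator G) : IsWaist M := by
  refine ⟨hM, fun N hN => ?_⟩
  by_cases hc : commutator G ≤ N
  · exact Or.inr (hlt.le.trans hc)
  · exact h N M hN hM hc hlt.not_ge

/-- Existence is where `G` must be nonabelian: nothing lies strictly below `G' = ⊥`. Two candidates
are comparable, and chiefness identifies them. -/
theorem existsUnique_isChiefFactor_of_chain [Finite G]
    (h : ∀ N₁ N₂ : Subgroup G, N₁.Normal → N₂.Normal →
      ¬ commutator G ≤ N₁ → ¬ commutator G ≤ N₂ → N₁ ≤ N₂ ∨ N₂ ≤ N₁)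
    (hG : commutator G ≠ ⊥) : ∃! M : Subgroup G, IsChiefFactor (commutator G) M := by
  obtain ⟨M, -, hM⟩ := exists_le_isChiefFactor (H := commutator G) (X := ⊥) inferInstance
    inferInstance (bot_lt_iff_ne_bot.2 hG)
  refine ⟨M, hM, fun K hK => ?_⟩
  rcases h K M hK.2.1 hM.2.1 hK.2.2.1.not_ge hM.2.2.1.not_ge with hle | hle
  · exact ((hK.2.2.2 M hM.2.1 hle hM.2.2.1.le).resolve_right hM.2.2.1.ne).symm
  · exact (hM.2.2.2 K hK.2.1 hle hK.2.2.1.le).resolve_right hK.2.2.1.ne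

end Chain

theorem commutator_ne_bot_of_mul_ne_mul {G : Type*} [Group G] {a b : G} (h : a * b ≠ b * a) :
    commutator G ≠ ⊥ := by
  intro hG
  have h1 := Subgroup.commutator_mem_commutator (Subgroup.mem_top a) (Subgroup.mem_top b)
  rw [← commutator_def, hG, Subgroup.mem_bot] at h1
  exact h (commutatorElement_eq_one_iff_mul_comm.1 h1)

/-- In (2), "for this `M`" is rendered by a universal quantifier, harmless beside the uniqueness
clause. -/
theorem theorem1p2 {G : Type*} [Group G] [Finite G] :
    (IsChain (· ⊆ ·) (nlKern G) ↔
      ∀ (M : Subgroup G) [M.Normal], M < commutator G →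
        (¬ IsChiefFactor (commutator G) M ∧ ∃! N : Subgroup (G ⧸ M), IsMinimalNormal N) ∨
        (IsChiefFactor (commutator G) M ∧ {N : Subgroup (G ⧸ M) | IsMinimalNormal N}.encard ≤ 2))
    ∧
    ((∃ a b : G, a * b ≠ b * a) →
      (IsChain (· ⊆ ·) (nlKern G) ↔
        (∀ M : Subgroup G, M.Normal → M < commutator G → IsWaist M) ∧
        (∃! M : Subgroup G, IsChiefFactor (commutator G) M) ∧
        (∀ (M : Subgroup G) [M.Normal], IsChiefFactor (commutator G) M →
          {N : Subgroup (G ⧸ M) | IsMinimalNormal N}.encard ≤ 2))) := by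
  rw [isChain_nlKern_iff]
  refine ⟨⟨fun h M _ hlt => ?_, fun h N₁ N₂ hN₁ hN₂ h₁ h₂ =>
    chain_of_minimalNormal h hN₁ hN₂ h₁ h₂⟩, ?_⟩
  · by_cases hM : IsChiefFactor (commutator G) M
    · exact Or.inr ⟨hM, encard_minimalNormal_le_two_of_chain h M hM⟩
    · exact Or.inl ⟨hM, existsUnique_minimalNormal_of_chain h M hlt hM⟩
  · rintro ⟨a, b, hab⟩
    refine ⟨fun h => ⟨fun M hM hlt => isWaist_of_chain h hM hlt,
      existsUnique_isChiefFactor_of_chain h (commutator_ne_bot_of_mul_ne_mul hab),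
      fun M _ hM => encard_minimalNormal_le_two_of_chain h M hM⟩, ?_⟩
    rintro ⟨hw, hu, hcard⟩ N₁ N₂ hN₁ hN₂ h₁ h₂
    exact chain_of_waist hw hu hcard hN₁ hN₂ h₁ h₂
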